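/- Let $s,n$ be integers with $2\le s\le n$. For integers $m,k\geq 0$ let $\mathcal P(m,k)$ denote the set of partitions of $m$ into exactly $k$ (positive) parts. For partitions $p,q$ of $n$ write $p\le q$ if $p$ can be obtained from $q$ by summing some of the parts of $q$ and then reordering. For a monic polynomial $F=T^n+F_1T^{n-1}+\dots+F_n\in\mathbb R[T]$ with only real roots, let the hyperbolic slice $\mathcal H_s(F)$ be the set of all monic polynomials $H=T^n+H_1T^{n-1}+\dots+H_n\in\mathbb R[T]$ with only real roots such that $H_i=F_i$ for $i=1,\dots,s$. For a monic polynomial $G$ of degree $n$ with only real roots, let $p(G)$ be the partition of $n$ formed by the multiplicities of its distinct roots. A set $P\subseteq\mathcal P(n,s)$ is an $(n,s)$-Vandermonde covering if for every monic $F\in\mathbb R[T]$ of degree $n$ with only real roots there are $q\in P$ and $G\in\mathcal H_s(F)$ with $p(G)\le q$. Then every $(n,s)$-Vandermonde covering $P$ satisfies \[|P|\;\geq\;\left\lceil\frac{2\left|\mathcal P\left(n-\left\lceil\frac s2\right\rceil,\left\lfloor\frac s2\right\rfloor\right)\right|}{\left\lceil\frac{s-1}2\right\rceil\left\lceil\frac{s+1}2\right\rceil}\right\rceil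 .\] -/

import Mathlib

namespace Vandermonde

open Polynomial

/-- Monic hyperbolic polynomials of degree `n`: monic real polynomials of degree `n`
all of whose roots are real. -/
def Hyperbolic (n : ℕ) : Type :=
  {F : ℝ[X] // F.Monic ∧ F.natDegree = n ∧ F.Splits}

/-- The hyperbolic slice of `F = T^n + F_1 T^(n-1) + ... + F_n`: all monic hyperbolic
polynomials `H` of degree `n` with `H_i = F_i` for `1 ≤ i ≤ s` (used for `s ≤ n`). -/
def hyperbolicSlice {n : ℕ} (s : ℕ) (F : Hyperbolic n) : Set (Hyperbolic n) :=
  {H | ∀ i ∈ Finset.Icc 1 s, H.1.coeff (n - i) = F.1.coeff (n - i)}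

/-- The multiset of all real roots of `H`, with multiplicity, has exactly `n` elements. -/
theorem card_roots {n : ℕ} (H : Hyperbolic n) : H.1.roots.card = n :=
  H.2.2.2.natDegree_eq_card_roots.symm.trans H.2.2.1

open Classical in
/-- The partition of `n` whose parts are the multiplicities of the distinct roots of `H`. -/
noncomputable def rootPartition {n : ℕ} (H : Hyperbolic n) : n.Partition :=
  Nat.Partition.ofSym (⟨H.1.roots, card_roots H⟩ : Sym ℝ n)

/-- `p ≤ q` in the order on partitions of `n`: the parts of `q` can be grouped into blocks
whose sums are the parts of `p`, i.e. `p` arises from `q` by summing some of the parts and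
reordering. -/
def PartitionLE {n : ℕ} (p q : n.Partition) : Prop :=
  ∃ B : Multiset (Multiset ℕ), B.join = q.parts ∧ B.map Multiset.sum = p.parts

/-- The set of partitions of `n` into exactly `s` parts. -/
def partitionsInto (n s : ℕ) : Finset n.Partition :=
  Finset.univ.filter fun p => p.parts.card = s

/-- `P` is an `(n, s)`-Vandermonde covering: it consists of partitions of `n` into `s` parts, and
every hyperbolic slice contains a polynomial `G` whose root partition is `≤` some `q ∈ P`. -/
def IsVandermondeCovering (n s : ℕ) (P : Finset n.Partition) : Prop :=
  P ⊆ partitionsInto n s ∧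
    ∀ F : Hyperbolic n, ∃ q ∈ P, ∃ G ∈ hyperbolicSlice s F, PartitionLE (rootPartition G) q

end Vandermonde

namespace Vandermonde

open Polynomial

/-! Write `s = k + l + 1` with `k = ⌊s/2⌋`, so `k = l` or `k = l + 1`. A partition of `n` with `k`
arbitrary parts and `l` further parts `1` is realised by roots `0, 1, ..., k + l - 1` whose odd
members are simple. Such an `F` is rigid: its slice is `{F}`, so a covering must contain some `q`
above this partition.

Rigidity: members of the slice share power sums up to `s`, hence `∑ Q(x i) = ∑ Q(y i)` for the
sorted roots and any `Q` of degree at most `s`. A suitable `Q` satisfies `Q(y i) ≤ Q(x i)` with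
equality only at `x i = y i`, which forces `x = y`.

Counting: `q` has one part more than `p`, so `p` sums one pair of parts of `q`. The sum is at least
`2`, so the pair avoids `l` ones of `q`, leaving at most `(k + 1).choose 2` partitions `p` per `q`.
-/

/-! ### Rigidity of tuples with prescribed power sums -/

theorem eval_le_of_derivative_nonpos {Q : ℝ[X]} (hQ : derivative Q ≠ 0) {u v : ℝ} (huv : u ≤ v)
    (h : ∀ t, u < t → t < v → (derivative Q).eval t ≤ 0) :
    Q.eval v ≤ Q.eval u ∧ (Q.eval v = Q.eval u → u = v) := by
  have hanti : AntitoneOn (fun t => Q.eval t) (Set.Icc u v) := by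
    apply antitoneOn_of_deriv_nonpos (convex_Icc u v) Q.continuous.continuousOn
      Q.differentiable.differentiableOn
    intro t ht
    rw [interior_Icc] at ht
    rw [Polynomial.deriv]
    exact h t ht.1 ht.2
  have hu : u ∈ Set.Icc u v := ⟨le_rfl, huv⟩
  have hv : v ∈ Set.Icc u v := ⟨huv, le_rfl⟩
  refine ⟨hanti hu hv huv, fun heq => ?_⟩
  by_contra hne
  have hlt : u < v := lt_of_le_of_ne huv hne
  apply hQ
  have : Q = C (Q.eval u) := by
    apply Polynomial.eq_of_infinite_eval_eq
    refine (Set.Icc_infinite hlt).mono fun t ht => ?_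
    have h1 := hanti hu ht ht.1
    have h2 := hanti ht hv ht.2
    simp only [Set.mem_ofPred_eq, eval_C]
    simp only at h1 h2
    linarith
  rw [this, derivative_C]

theorem exists_derivative_eq (q : ℝ[X]) {s : ℕ} (hq : q.natDegree < s) :
    ∃ Q : ℝ[X], derivative Q = q ∧ Q.natDegree < s + 1 := by
  refine ⟨∑ i ∈ Finset.range s, C (q.coeff i / (i + 1)) * X ^ (i + 1), ?_, ?_⟩
  · conv_rhs => rw [q.as_sum_range' s hq]
    rw [derivative_sum]
    refine Finset.sum_congr rfl fun i _ => ?_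
    rw [derivative_C_mul_X_pow, ← C_mul_X_pow_eq_monomial]
    have : ((i : ℝ) + 1) ≠ 0 := by positivity
    push_cast
    rw [div_mul_cancel₀ _ this]
  · refine Nat.lt_succ_of_le (natDegree_sum_le_of_forall_le _ _ fun i hi => ?_)
    exact (natDegree_C_mul_X_pow_le _ _).trans (Finset.mem_range.mp hi)

/-- An antiderivative `Q` of `q` strictly decreases on passing from `x i` to a different `y i`,
whichever is larger, while equal power sums keep `∑ Q` unchanged. -/
theorem eq_of_power_sums_eq {n s : ℕ} {x y : Fin n → ℝ}
    (hxy : ∀ j ≤ s, ∑ i, x i ^ j = ∑ i, y i ^ j) {q : ℝ[X]} (hq0 : q ≠ 0)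
    (hq : q.natDegree < s)
    (hneg : ∀ i t, x i < t → t < y i → q.eval t ≤ 0)
    (hpos : ∀ i t, y i < t → t < x i → 0 ≤ q.eval t) : x = y := by
  obtain ⟨Q, rfl, hQ⟩ := exists_derivative_eq q hq
  have key : ∀ i, Q.eval (y i) ≤ Q.eval (x i) ∧ (Q.eval (y i) = Q.eval (x i) → x i = y i) := by
    intro i
    rcases le_total (x i) (y i) with h | h
    · exact eval_le_of_derivative_nonpos hq0 h (hneg i)
    · have := eval_le_of_derivative_nonpos (Q := -Q) (by simpa using hq0) h
        (fun t h1 h2 => by simpa using hpos i t h1 h2)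
      simp only [eval_neg, neg_le_neg_iff, neg_inj] at this
      exact ⟨this.1, fun e => (this.2 e.symm).symm⟩
  have hsum : ∑ i, Q.eval (y i) = ∑ i, Q.eval (x i) := by
    simp only [eval_eq_sum_range' hQ]
    rw [Finset.sum_comm, Finset.sum_comm (s := Finset.univ)]
    refine Finset.sum_congr rfl fun j hj => ?_
    rw [← Finset.mul_sum, ← Finset.mul_sum, hxy j (Nat.lt_succ_iff.mp (Finset.mem_range.mp hj))]
  have := (Finset.sum_eq_sum_iff_of_le fun i _ => (key i).1).mp hsum
  exact funext fun i => (key i).2 (this i (Finset.mem_univ i))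

/-- Only `x (ι j)` can lie strictly between the nodes `a j` and `a (j + 1)`. With `c j` the clamp of
`y (ι j)` to that gap, `(t - a j) * (t - c j)` is negative exactly on `(a j, c j)`. Monotonicity of
`y` shows that upward moves meet the gap only inside `[a j, c j)` and downward moves never enter `(a
j, c j)`. -/
theorem exists_sign_polynomial {n l : ℕ} {x y : Fin n → ℝ} (hy : Monotone y) {a : ℕ → ℝ}
    (ha : Monotone a) {ι : ℕ → Fin n}
    (hlow : ∀ j < l, ∀ i < ι j, x i ≤ a j) (hhigh : ∀ j < l, ∀ i, ι j < i → a (j + 1) ≤ x i)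
    (h0 : ∀ i, a 0 ≤ x i) :
    ∃ g : ℝ[X], g.Monic ∧ g.natDegree = 2 * l ∧
      (∀ i t, x i < t → t < y i → t < a l → g.eval t ≤ 0) ∧
      (∀ i t, y i < t → t < x i → 0 ≤ g.eval t) ∧ (∀ t, a l ≤ t → 0 ≤ g.eval t) := by
  set c : ℕ → ℝ := fun j => max (a j) (min (y (ι j)) (a (j + 1))) with hc
  have hac : ∀ j, a j ≤ c j := fun j => le_max_left _ _
  have hca : ∀ j, c j ≤ a (j + 1) := fun j => max_le (ha (Nat.le_succ j)) (min_le_right _ _)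
  have hfac : ∀ j t, ¬ (a j < t ∧ t < c j) → 0 ≤ (t - a j) * (t - c j) := by
    intro j t h
    rcases le_or_gt t (a j) with h1 | h1
    · exact mul_nonneg_of_nonpos_of_nonpos (by linarith) (by linarith [hac j])
    · have : c j ≤ t := not_lt.mp fun h2 => h ⟨h1, h2⟩
      exact mul_nonneg (by linarith) (by linarith)
  have heval : ∀ t, (∏ j ∈ Finset.range l, ((X - C (a j)) * (X - C (c j)))).eval t
      = ∏ j ∈ Finset.range l, ((t - a j) * (t - c j)) := by
    intro t; simp [eval_prod]
  have hmonic : ∀ j ∈ Finset.range l, ((X - C (a j)) * (X - C (c j))).Monic :=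
    fun j _ => (monic_X_sub_C _).mul (monic_X_sub_C _)
  refine ⟨∏ j ∈ Finset.range l, ((X - C (a j)) * (X - C (c j))), monic_prod_of_monic _ _ hmonic,
    ?_, ?_, ?_, ?_⟩
  · rw [natDegree_prod_of_monic _ _ hmonic]
    simp [(monic_X_sub_C _).natDegree_mul (monic_X_sub_C _), mul_comm]
  · intro i t hxt hty htl
    rw [heval]
    obtain ⟨j, hj, hj1, hj2⟩ : ∃ j < l, a j ≤ t ∧ t < a (j + 1) := by
      by_contra! hcon
      have : ∀ j ≤ l, a j ≤ t := by
        intro j hj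
        induction j with
        | zero => exact (h0 i).trans hxt.le
        | succ j ih => exact hcon j hj (ih (Nat.le_of_succ_le hj))
      exact absurd (this l le_rfl) (not_le.mpr htl)
    have htc : t < c j := by
      have : i ≤ ι j := not_lt.mp fun h => absurd (hhigh j hj i h) (by linarith)
      exact lt_max_of_lt_right (lt_min (hty.trans_le (hy this)) hj2)
    rw [← Finset.mul_prod_erase _ _ (Finset.mem_range.mpr hj)]
    refine mul_nonpos_of_nonpos_of_nonneg
      (mul_nonpos_of_nonneg_of_nonpos (by linarith) (by linarith)) ?_
    refine Finset.prod_nonneg fun j' hj' => hfac _ _ ?_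
    rintro ⟨h1, h2⟩
    rcases lt_or_gt_of_ne (Finset.ne_of_mem_erase hj') with h | h
    · linarith [hca j', ha (Nat.succ_le_of_lt h)]
    · linarith [ha (Nat.succ_le_of_lt h)]
  · intro i t hyt htx
    rw [heval]
    refine Finset.prod_nonneg fun j hj => hfac _ _ ?_
    rw [Finset.mem_range] at hj
    rintro ⟨h1, h2⟩
    have hi : ι j ≤ i := not_lt.mp fun h => absurd (hlow j hj i h) (by linarith)
    have := hy hi
    rcases lt_max_iff.mp h2 with h | h
    · linarith
    · linarith [min_le_left (y (ι j)) (a (j + 1))]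
  · intro t ht
    rw [heval]
    refine Finset.prod_nonneg fun j hj => hfac _ _ ?_
    rintro ⟨h1, h2⟩
    linarith [hca j, ha (Nat.succ_le_of_lt (Finset.mem_range.mp hj))]

/-- The extra factor `-(t - a l)` supplies the missing sign to the right of `a l`, where only upward
moves occur. -/
theorem exists_sign_polynomial_of_le {n l : ℕ} {x y : Fin n → ℝ} (hy : Monotone y) {a : ℕ → ℝ}
    (ha : Monotone a) {ι : ℕ → Fin n}
    (hlow : ∀ j < l, ∀ i < ι j, x i ≤ a j) (hhigh : ∀ j < l, ∀ i, ι j < i → a (j + 1) ≤ x i)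
    (h0 : ∀ i, a 0 ≤ x i) (hl : ∀ i, x i ≤ a l) :
    ∃ q : ℝ[X], q ≠ 0 ∧ q.natDegree = 2 * l + 1 ∧
      (∀ i t, x i < t → t < y i → q.eval t ≤ 0) ∧
      (∀ i t, y i < t → t < x i → 0 ≤ q.eval t) := by
  obtain ⟨g, hg, hdeg, hneg, hpos, hlast⟩ := exists_sign_polynomial hy ha hlow hhigh h0
  refine ⟨-(g * (X - C (a l))), neg_ne_zero.mpr (hg.mul (monic_X_sub_C _)).ne_zero, ?_, ?_, ?_⟩
  · rw [natDegree_neg, hg.natDegree_mul (monic_X_sub_C _), hdeg, natDegree_X_sub_C]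
  · intro i t h1 h2
    simp only [eval_neg, eval_mul, eval_sub, eval_X, eval_C]
    rcases lt_or_ge t (a l) with h | h
    · nlinarith [hneg i t h1 h2 h]
    · nlinarith [hlast t h]
  · intro i t h1 h2
    simp only [eval_neg, eval_mul, eval_sub, eval_X, eval_C]
    nlinarith [hpos i t h1 h2, hl i]

theorem eq_of_power_sums_eq_of_alternating {n k l : ℕ} (hkl : k = l ∨ k = l + 1)
    {x y : Fin n → ℝ} (hx : Monotone x) (hy : Monotone y)
    (hval : ∀ i, ∃ v < k + l, x i = (v : ℕ))
    (hodd : ∀ j < l, ∃! i, x i = ((2 * j + 1 : ℕ) : ℝ))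
    (hxy : ∀ j ≤ k + l + 1, ∑ i, x i ^ j = ∑ i, y i ^ j) : x = y := by
  rcases n.eq_zero_or_pos with rfl | hn
  · exact Subsingleton.elim _ _
  have : ∀ j, ∃ i : Fin n, j < l →
      (∀ i' < i, x i' ≤ 2 * (j : ℝ)) ∧ ∀ i', i < i' → 2 * ((j : ℝ) + 1) ≤ x i' := by
    intro j
    by_cases hj : j < l
    · obtain ⟨i, hi, huniq⟩ := hodd j hj
      refine ⟨i, fun _ => ⟨fun i' h => ?_, fun i' h => ?_⟩⟩
      · obtain ⟨v, -, hv⟩ := hval i'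
        have h1 : x i' ≠ ((2 * j + 1 : ℕ) : ℝ) := fun e => h.ne (huniq i' e)
        have h2 : x i' ≤ ((2 * j + 1 : ℕ) : ℝ) := hi ▸ hx h.le
        rw [hv] at h1 h2 ⊢
        norm_cast at h1 h2 ⊢
        omega
      · obtain ⟨v, -, hv⟩ := hval i'
        have h1 : x i' ≠ ((2 * j + 1 : ℕ) : ℝ) := fun e => h.ne' (huniq i' e)
        have h2 : ((2 * j + 1 : ℕ) : ℝ) ≤ x i' := hi ▸ hx h.le
        rw [hv] at h1 h2 ⊢
        norm_cast at h1 h2 ⊢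
        omega
    · exact ⟨⟨0, hn⟩, fun h => absurd h hj⟩
  choose ι hι using this
  have h0 : ∀ i, 0 ≤ x i := fun i => by
    obtain ⟨v, -, hv⟩ := hval i
    rw [hv]; positivity
  have hle : ∀ i, x i ≤ ((k + l - 1 : ℕ) : ℝ) := fun i => by
    obtain ⟨v, hlt, hv⟩ := hval i
    rw [hv]; norm_cast; omega
  rcases hkl with rfl | rfl
  · obtain ⟨M, hM⟩ := (Set.finite_range y).bddAbove
    have hyM : ∀ i, y i ≤ max M 0 := fun i => (hM ⟨i, rfl⟩).trans (le_max_left _ _)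
    have hM0 : 0 ≤ max M 0 := le_max_right _ _
    -- The largest admissible value `2 * k - 1` is odd, so the last gap has no root at its right
    -- end. Its end `a k` is pushed beyond every `y i`, so no extra linear factor is needed.
    set a : ℕ → ℝ := fun j => 2 * (j : ℝ) + if k ≤ j then max M 0 else 0 with ha_def
    have ha : Monotone a := by
      refine monotone_nat_of_le_succ fun j => ?_
      simp only [ha_def]
      push_cast
      split_ifs <;> linarith
    have haj : ∀ j < k, a j = 2 * (j : ℝ) := fun j hj => by
      simp [ha_def, not_le.mpr hj]
    have hal : a k = 2 * (k : ℝ) + max M 0 := by simp [ha_def]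
    have hk : 0 < k := by
      obtain ⟨v, hlt, -⟩ := hval ⟨0, hn⟩
      omega
    obtain ⟨g, hg, hdeg, hneg, hpos, -⟩ := exists_sign_polynomial (x := x) (l := k) hy ha (ι := ι)
      (fun j hj i hi => by rw [haj j hj]; exact (hι j hj).1 i hi)
      (fun j hj i hi => by
        have h1 := (hι j hj).2 i hi
        rcases (Nat.succ_le_of_lt hj).lt_or_eq with h | h
        · rw [haj (j + 1) h]; push_cast; exact h1
        · exfalso
          obtain ⟨v, hlt, hv⟩ := hval i
          rw [hv] at h1
          norm_cast at h1
          omega)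
      (fun i => by rw [haj 0 hk]; simpa using h0 i)
    refine eq_of_power_sums_eq hxy hg.ne_zero (by omega) (fun i t h1 h2 => hneg i t h1 h2 ?_) hpos
    have := hyM i
    have : (0 : ℝ) ≤ k := k.cast_nonneg
    linarith
  · obtain ⟨q, hq, hdeg, hneg, hpos⟩ := exists_sign_polynomial_of_le (x := x) (l := l) hy
      (a := fun j => 2 * (j : ℝ)) (ι := ι) (fun i j h => by dsimp only; gcongr)
      (fun j hj => (hι j hj).1) (fun j hj => by push_cast; exact (hι j hj).2)
      (by simpa using h0) (fun i => (hle i).trans (by norm_cast; omega))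
    exact eq_of_power_sums_eq hxy hq (by omega) hneg hpos

/-! ### From coefficients to power sums: slices that fix the roots -/

theorem power_sums_eq_of_esymm_eq {n s : ℕ} {x y : Fin n → ℝ}
    (h : ∀ j ≤ s, (Finset.univ.val.map x).esymm j = (Finset.univ.val.map y).esymm j) :
    ∀ j ≤ s, ∑ i, x i ^ j = ∑ i, y i ^ j := by
  intro j
  induction j using Nat.strong_induction_on with
  | _ j ih =>
    intro hj
    rcases j.eq_zero_or_pos with rfl | hpos
    · simp
    have key : ∀ z : Fin n → ℝ, ∑ i, z i ^ j =
        (-1) ^ (j + 1) * j * (Finset.univ.val.map z).esymm j -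
          ∑ a ∈ Finset.HasAntidiagonal.antidiagonal j with a.1 ∈ Set.Ioo 0 j,
            (-1) ^ a.1 * (Finset.univ.val.map z).esymm a.1 * ∑ i, z i ^ a.2 := by
      intro z
      have := congrArg (MvPolynomial.aeval z) (MvPolynomial.psum_eq_mul_esymm_sub_sum (Fin n) ℝ j hpos)
      simpa [MvPolynomial.psum, ← MvPolynomial.aeval_esymm_eq_multiset_esymm (Fin n) ℝ,
        -Fin.univ_val_map] using this
    rw [key x, key y, h j hj]
    congr 1
    refine Finset.sum_congr rfl fun a ha => ?_
    simp only [Finset.mem_filter, Finset.HasAntidiagonal.mem_antidiagonal, Set.mem_Ioo] at ha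
    rw [h a.1 (by omega), ih a.2 (by omega) (by omega)]

theorem exists_monotone_map_eq {n : ℕ} {R : Multiset ℝ} (hR : R.card = n) :
    ∃ x : Fin n → ℝ, Monotone x ∧ Finset.univ.val.map x = R := by
  obtain ⟨z, hz⟩ : ∃ z : Fin n → ℝ, Finset.univ.val.map z = R := by
    subst hR
    refine ⟨fun i => R.toList.get (i.cast (Multiset.length_toList R).symm), ?_⟩
    rw [Fin.univ_val_map, ← List.ofFn_congr (Multiset.length_toList R) R.toList.get,
      List.ofFn_get, Multiset.coe_toList]
  refine ⟨z ∘ Tuple.sort z, Tuple.monotone_sort z, ?_⟩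
  rw [← Multiset.map_map, Multiset.map_univ_val_equiv, hz]

theorem esymm_roots_eq_of_mem_hyperbolicSlice {n s : ℕ} (hsn : s ≤ n) {F G : Hyperbolic n}
    (hG : G ∈ hyperbolicSlice s F) : ∀ j ≤ s, G.1.roots.esymm j = F.1.roots.esymm j := by
  intro j hj
  rcases j.eq_zero_or_pos with rfl | hpos
  · simp [Multiset.esymm]
  have key : ∀ H : Hyperbolic n, H.1.coeff (n - j) = (-1) ^ j * H.1.roots.esymm j := by
    intro H
    have := coeff_eq_esymm_roots_of_card (p := H.1) (k := n - j)
      ((card_roots H).trans H.2.2.1.symm) (by rw [H.2.2.1]; omega)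
    rwa [H.2.1.leadingCoeff, H.2.2.1, one_mul, Nat.sub_sub_self (hj.trans hsn)] at this
  have := hG j (Finset.mem_Icc.mpr ⟨hpos, hj⟩)
  rw [key, key] at this
  exact mul_left_cancel₀ (by simp) this

theorem roots_eq_of_mem_hyperbolicSlice {n k l : ℕ} (hkl : k = l ∨ k = l + 1)
    (hsn : k + l + 1 ≤ n) {F G : Hyperbolic n}
    (hval : ∀ r ∈ F.1.roots, ∃ v < k + l, r = (v : ℕ))
    (hodd : ∀ j < l, F.1.roots.count ((2 * j + 1 : ℕ) : ℝ) = 1)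
    (hG : G ∈ hyperbolicSlice (k + l + 1) F) : G.1.roots = F.1.roots := by
  obtain ⟨x, hx, hxF⟩ := exists_monotone_map_eq (card_roots F)
  obtain ⟨y, hy, hyG⟩ := exists_monotone_map_eq (card_roots G)
  have : x = y := by
    refine eq_of_power_sums_eq_of_alternating hkl hx hy (fun i => hval _ ?_) (fun j hj => ?_) ?_
    · rw [← hxF]
      exact Multiset.mem_map_of_mem _ (Finset.mem_univ i)
    · have h := hodd j hj
      rw [← hxF, Multiset.count_map, ← Finset.filter_val, Finset.card_val, Finset.card_eq_one] at h
      obtain ⟨i, hi⟩ := h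
      simp only [Finset.ext_iff, Finset.mem_filter, Finset.mem_univ, true_and,
        Finset.mem_singleton] at hi
      exact ⟨i, ((hi i).mpr rfl).symm, fun i' h => (hi i').mp h.symm⟩
    · refine power_sums_eq_of_esymm_eq fun j hj => ?_
      rw [hxF, hyG, esymm_roots_eq_of_mem_hyperbolicSlice hsn hG j hj]
  rw [← hxF, ← hyG, this]

theorem rootPartition_congr {n : ℕ} {F G : Hyperbolic n} (h : G.1.roots = F.1.roots) :
    rootPartition G = rootPartition F := by
  unfold rootPartition
  congr 1
  exact Subtype.ext h

/-! ### Partitions obtained by merging one pair of parts -/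

theorem card_le_card_join {B : Multiset (Multiset ℕ)} (hB : ∀ b ∈ B, b ≠ 0) :
    B.card ≤ B.join.card := by
  induction B using Multiset.induction with
  | empty => simp
  | cons b B ih =>
    have h1 := ih fun c hc => hB c (Multiset.mem_cons_of_mem hc)
    have h2 := Multiset.card_pos.mpr (hB b (Multiset.mem_cons_self b B))
    rw [Multiset.join_cons, Multiset.card_add, Multiset.card_cons]
    omega

theorem map_sum_eq_join {B : Multiset (Multiset ℕ)} (hB : ∀ b ∈ B, b ≠ 0)
    (hcard : B.join.card = B.card) : B.map Multiset.sum = B.join := by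
  induction B using Multiset.induction with
  | empty => simp
  | cons b B ih =>
    have hB' : ∀ c ∈ B, c ≠ 0 := fun c hc => hB c (Multiset.mem_cons_of_mem hc)
    have h1 := card_le_card_join hB'
    have h2 := Multiset.card_pos.mpr (hB b (Multiset.mem_cons_self b B))
    rw [Multiset.join_cons, Multiset.card_add, Multiset.card_cons] at hcard
    obtain ⟨u, rfl⟩ := Multiset.card_eq_one.mp (show b.card = 1 by omega)
    rw [Multiset.map_cons, Multiset.join_cons, ih hB' (by omega)]
    simp

/-- One surplus element among nonempty blocks means one block of size two and singletons otherwise.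
-/
theorem exists_pair_of_card_join {B : Multiset (Multiset ℕ)} (hB : ∀ b ∈ B, b ≠ 0)
    (hcard : B.join.card = B.card + 1) :
    ∃ w C : Multiset ℕ, w.card = 2 ∧ B.join = w + C ∧ B.map Multiset.sum = C + {w.sum} := by
  induction B using Multiset.induction with
  | empty => simp at hcard
  | cons b B ih =>
    have hB' : ∀ c ∈ B, c ≠ 0 := fun c hc => hB c (Multiset.mem_cons_of_mem hc)
    have h1 := card_le_card_join hB'
    have h2 := Multiset.card_pos.mpr (hB b (Multiset.mem_cons_self b B))
    rw [Multiset.join_cons, Multiset.card_add, Multiset.card_cons] at hcard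
    rcases (show b.card = 1 ∨ b.card = 2 by omega) with h | h
    · obtain ⟨w, C, hw, hj, hs⟩ := ih hB' (by omega)
      obtain ⟨u, rfl⟩ := Multiset.card_eq_one.mp h
      refine ⟨w, {u} + C, hw, ?_, ?_⟩
      · rw [Multiset.join_cons, hj, add_left_comm]
      · rw [Multiset.map_cons, hs, Multiset.sum_singleton, ← Multiset.singleton_add, add_assoc]
    · refine ⟨b, B.join, h, Multiset.join_cons _ _, ?_⟩
      rw [Multiset.map_cons, map_sum_eq_join hB' (by omega), ← Multiset.singleton_add, add_comm]

theorem PartitionLE.exists_pair {n : ℕ} {p q : n.Partition} (h : PartitionLE p q)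
    (hcard : q.parts.card = p.parts.card + 1) :
    ∃ w ≤ q.parts, w.card = 2 ∧ p.parts = q.parts - w + {w.sum} := by
  obtain ⟨B, hq, hp⟩ := h
  have hB : ∀ b ∈ B, b ≠ 0 := by
    rintro b hb rfl
    have : (0 : ℕ) ∈ p.parts := hp ▸ Multiset.mem_map.mpr ⟨0, hb, rfl⟩
    exact absurd (p.parts_pos this) (lt_irrefl 0)
  obtain ⟨w, C, hw, hj, hs⟩ := exists_pair_of_card_join hB (by
    rw [hq, hcard, ← hp, Multiset.card_map])
  rw [hq] at hj
  refine ⟨w, hj ▸ Multiset.le_add_right w C, hw, ?_⟩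
  rw [← hp, hs, hj, add_tsub_cancel_left]

theorem card_le_choose_of_partitionLE {n k l : ℕ} {q : n.Partition}
    (hq : q.parts.card = k + l + 1) {S : Finset n.Partition}
    (hS : ∀ p ∈ S, PartitionLE p q ∧ p.parts.card = k + l ∧ Multiset.replicate l 1 ≤ p.parts) :
    S.card ≤ (k + 1).choose 2 := by
  classical
  have key : ∀ p ∈ S, ∃ w : Multiset ℕ, w + Multiset.replicate l 1 ≤ q.parts ∧ w.card = 2 ∧
      p.parts = q.parts - w + {w.sum} := by
    intro p hp
    obtain ⟨hle, hcard, hones⟩ := hS p hp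
    obtain ⟨w, hw, hw2, hpw⟩ := hle.exists_pair (by rw [hq, hcard])
    refine ⟨w, ?_, hw2, hpw⟩
    -- The merged part is not `1`, so the `l` ones of `p` all survive from `q` outside `w`.
    have hsum : w.sum ≠ 1 := by
      obtain ⟨u, v, rfl⟩ := Multiset.card_eq_two.mp hw2
      have hu : 0 < u := q.parts_pos (Multiset.mem_of_le hw (by simp))
      have hv : 0 < v := q.parts_pos (Multiset.mem_of_le hw (by simp))
      simp only [Multiset.insert_eq_cons, Multiset.sum_cons, Multiset.sum_singleton]
      omega
    rw [hpw, ← Multiset.le_count_iff_replicate_le, Multiset.count_add,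
      Multiset.count_singleton, if_neg hsum.symm, add_zero,
      Multiset.le_count_iff_replicate_le] at hones
    calc w + Multiset.replicate l 1 ≤ w + (q.parts - w) := by gcongr
      _ = q.parts := add_tsub_cancel_of_le hw
  rcases S.eq_empty_or_nonempty with rfl | ⟨p₀, hp₀⟩
  · simp
  obtain ⟨w₀, hw₀, -⟩ := key p₀ hp₀
  have hcard : (q.parts - Multiset.replicate l 1).card = k + 1 := by
    rw [Multiset.card_sub ((Multiset.le_add_left _ _).trans hw₀), hq, Multiset.card_replicate]
    omega
  calc S.card = (S.image Nat.Partition.parts).card :=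
        (Finset.card_image_of_injective _ fun _ _ => Nat.Partition.ext).symm
    _ ≤ (((q.parts - Multiset.replicate l 1).powersetCard 2).map
          fun w : Multiset ℕ => q.parts - w + {w.sum}).toFinset.card := by
        refine Finset.card_le_card fun m hm => ?_
        obtain ⟨p, hp, rfl⟩ := Finset.mem_image.mp hm
        obtain ⟨w, hw, hw2, hpw⟩ := key p hp
        rw [Multiset.mem_toFinset, Multiset.mem_map]
        exact ⟨w, Multiset.mem_powersetCard.mpr ⟨le_tsub_of_add_le_right hw, hw2⟩, hpw.symm⟩
    _ ≤ _ := Multiset.toFinset_card_le _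
    _ = (k + 1).choose 2 := by rw [Multiset.card_map, Multiset.card_powersetCard, hcard]

/-- Raising one largest part by `1` is injective: the result has a largest part that reveals which
part was raised. -/
theorem card_partitionsInto_le_succ (m : ℕ) {k : ℕ} (hk : 0 < k) :
    (partitionsInto m k).card ≤ (partitionsInto (m + 1) k).card := by
  classical
  have hmax : ∀ p ∈ partitionsInto m k, p.parts.sup ∈ p.parts := by
    intro p hp
    have hne : p.parts ≠ 0 := by
      rw [← Multiset.card_pos, (Finset.mem_filter.mp hp).2]; exact hk
    obtain ⟨M, hM, hle⟩ := p.parts.toFinset.exists_max_image id (Multiset.toFinset_nonempty.mpr hne)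
    simp only [Multiset.mem_toFinset, id] at hM hle
    have : p.parts.sup = M := le_antisymm (Multiset.sup_le.mpr hle) (Multiset.le_sup hM)
    rwa [this]
  let f : Multiset ℕ → Multiset ℕ := fun p => (p.sup + 1) ::ₘ p.erase p.sup
  have hsup : ∀ p : Multiset ℕ, (f p).sup = p.sup + 1 := by
    intro p
    simp only [f, Multiset.sup_cons]
    exact sup_eq_left.mpr ((Multiset.sup_mono (Multiset.erase_subset _ _)).trans (Nat.le_succ _))
  have hsum : ∀ p ∈ partitionsInto m k, (f p.parts).sum = m + 1 := by
    intro p hp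
    have := congrArg Multiset.sum (Multiset.cons_erase (hmax p hp))
    rw [Multiset.sum_cons, p.parts_sum] at this
    simp only [f, Multiset.sum_cons]
    omega
  have hinj : Set.InjOn (fun p : m.Partition => f p.parts) (partitionsInto m k) := by
    intro p hp q hq hpq
    dsimp only at hpq
    have h1 : p.parts.sup = q.parts.sup := by
      have := congrArg Multiset.sup hpq
      rw [hsup, hsup] at this
      omega
    have h2 : p.parts.erase p.parts.sup = q.parts.erase q.parts.sup := by
      simp only [f, h1] at hpq
      rw [h1]
      exact (Multiset.cons_inj_right _).mp hpq
    refine Nat.Partition.ext ?_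
    rw [← Multiset.cons_erase (hmax p hp), ← Multiset.cons_erase (hmax q hq), h2, h1]
  rw [← Finset.card_image_of_injOn hinj, ← Finset.card_image_of_injective
    (partitionsInto (m + 1) k) (fun _ _ => Nat.Partition.ext : Function.Injective
      (Nat.Partition.parts (n := m + 1)))]
  refine Finset.card_le_card fun M hM => ?_
  obtain ⟨p, hp, rfl⟩ := Finset.mem_image.mp hM
  refine Finset.mem_image.mpr ⟨⟨f p.parts, ?_, hsum p hp⟩, ?_, rfl⟩
  · intro i hi
    rcases Multiset.mem_cons.mp hi with rfl | hi
    · exact Nat.succ_pos _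
    · exact p.parts_pos (Multiset.mem_of_mem_erase hi)
  · refine Finset.mem_filter.mpr ⟨Finset.mem_univ _, ?_⟩
    rw [← (Finset.mem_filter.mp hp).2]
    exact (Multiset.card_cons _ _).trans (Multiset.card_erase_add_one (hmax p hp))

/-! ### Realising partitions by rigid polynomials, and the count -/

theorem exists_alternating_function {μ : Multiset ℕ} {l : ℕ} (hμ : μ.card = l ∨ μ.card = l + 1) :
    ∃ e : ℕ → ℕ, (∀ j, e (2 * j + 1) = 1) ∧
      (Multiset.range (μ.card + l)).map e = μ + Multiset.replicate l 1 := by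
  obtain ⟨g, hg⟩ : ∃ g : ℕ → ℕ, (Multiset.range μ.card).map g = μ := by
    refine ⟨fun i => μ.toList.getD i 0, ?_⟩
    conv_rhs => rw [← Multiset.coe_toList μ]
    rw [← Multiset.length_toList, ← Multiset.coe_range, Multiset.map_coe]
    congr 1
    refine List.ext_getElem (by simp) fun i h1 h2 => ?_
    rw [List.getElem_map, List.getElem_range, List.getD_eq_getElem _ _ h2]
  let e : ℕ → ℕ := fun v => if Even v then g (v / 2) else 1
  have heven : ∀ j, e (2 * j) = g j := fun j => by simp [e]
  have hodd : ∀ j, e (2 * j + 1) = 1 := fun j => by simp [e]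
  have key : ∀ m, (Multiset.range (2 * m)).map e =
      (Multiset.range m).map g + Multiset.replicate m 1 := by
    intro m
    induction m with
    | zero => simp
    | succ m ih =>
      rw [show 2 * (m + 1) = 2 * m + 1 + 1 by ring, Multiset.range_succ, Multiset.range_succ,
        Multiset.range_succ, Multiset.map_cons, Multiset.map_cons, Multiset.map_cons, ih,
        heven, hodd, Multiset.replicate_succ, Multiset.cons_add, Multiset.add_cons,
        Multiset.cons_swap]
  refine ⟨e, hodd, ?_⟩
  rcases hμ with h | h
  · rw [h, ← two_mul, key, ← h, hg]
  · rw [h, show l + 1 + l = 2 * l + 1 by ring, Multiset.range_succ, Multiset.map_cons, key, heven,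
      ← Multiset.cons_add, ← Multiset.map_cons g, ← Multiset.range_succ, Nat.succ_eq_add_one, ← h, hg]

theorem exists_hyperbolic_of_multiplicities {n N : ℕ} {e : ℕ → ℕ} (he : ∀ v < N, 0 < e v)
    (hsum : ((Multiset.range N).map e).sum = n) :
    ∃ F : Hyperbolic n, (rootPartition F).parts = (Multiset.range N).map e ∧
      (∀ v < N, F.1.roots.count (v : ℝ) = e v) ∧ ∀ r ∈ F.1.roots, ∃ v < N, r = (v : ℕ) := by
  classical
  set R : Multiset ℝ := ∑ v ∈ Finset.range N, Multiset.replicate (e v) (v : ℝ) with hR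
  have hmem : ∀ r, r ∈ R ↔ ∃ v < N, r = (v : ℕ) := by
    intro r
    simp only [hR, Multiset.mem_sum, Finset.mem_range, Multiset.mem_replicate]
    exact ⟨fun ⟨v, hv, _, h⟩ => ⟨v, hv, h⟩, fun ⟨v, hv, h⟩ => ⟨v, hv, (he v hv).ne', h⟩⟩
  have hcount : ∀ v < N, R.count (v : ℝ) = e v := by
    intro v hv
    simp [hR, Multiset.count_sum', Multiset.count_replicate, hv]
  have hcard : R.card = n := by
    rw [hR, Multiset.card_sum, ← hsum]
    simp [Finset.sum]
  have hroots : (R.map fun a => X - C a).prod.roots = R := roots_multiset_prod_X_sub_C R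
  let F : Hyperbolic n := ⟨(R.map fun a => X - C a).prod, monic_multisetProd_X_sub_C R,
    by rw [natDegree_multiset_prod_X_sub_C_eq_card, hcard], Splits.multisetProd fun f hf => by
      obtain ⟨a, -, rfl⟩ := Multiset.mem_map.mp hf
      exact Splits.X_sub_C a⟩
  have hF : F.1.roots = R := hroots
  refine ⟨F, ?_, fun v hv => by rw [hF]; exact hcount v hv, fun r hr => (hmem r).mp (hF ▸ hr)⟩
  have hdedup : R.dedup = (Multiset.range N).map fun v : ℕ => (v : ℝ) := by
    refine (Multiset.Nodup.ext (Multiset.nodup_dedup R)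
      ((Multiset.nodup_range N).map Nat.cast_injective)).mpr fun r => ?_
    simp only [Multiset.mem_dedup, hmem, Multiset.mem_map, Multiset.mem_range, eq_comm]
  have hparts : (rootPartition F).parts = R.dedup.map fun r => R.count r := by
    rw [← hF]
    unfold rootPartition Nat.Partition.ofSym
    congr!
  rw [hparts, hdedup, Multiset.map_map]
  exact Multiset.map_congr rfl fun v hv => hcount v (Multiset.mem_range.mp hv)

theorem exists_partitionLE_of_isVandermondeCovering {n k l : ℕ} (hkl : k = l ∨ k = l + 1)
    (hsn : k + l + 1 ≤ n) {P : Finset n.Partition} (hP : IsVandermondeCovering n (k + l + 1) P)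
    {p : n.Partition} {μ : Multiset ℕ} (hμ : μ.card = k)
    (hp : p.parts = μ + Multiset.replicate l 1) : ∃ q ∈ P, PartitionLE p q := by
  subst hμ
  obtain ⟨e, hodd, he⟩ := exists_alternating_function hkl
  have hpos : ∀ v < μ.card + l, 0 < e v := fun v hv => p.parts_pos (by
    rw [hp, ← he]
    exact Multiset.mem_map_of_mem e (Multiset.mem_range.mpr hv))
  obtain ⟨F, hF, hcount, hval⟩ := exists_hyperbolic_of_multiplicities hpos
    (by rw [he, ← hp, p.parts_sum])
  obtain ⟨q, hq, G, hG, hle⟩ := hP.2 F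
  refine ⟨q, hq, ?_⟩
  have hroots := roots_eq_of_mem_hyperbolicSlice hkl hsn hval
    (fun j hj => by rw [hcount _ (by omega), hodd]) hG
  have hpF : p = rootPartition F := Nat.Partition.ext (by rw [hp, hF, he])
  rwa [hpF, ← rootPartition_congr hroots]

theorem card_partitionsInto_le_mul_choose {n k l : ℕ} (hkl : k = l ∨ k = l + 1)
    (hsn : k + l + 1 ≤ n) {P : Finset n.Partition} (hP : IsVandermondeCovering n (k + l + 1) P) :
    (partitionsInto (n - l) k).card ≤ P.card * (k + 1).choose 2 := by
  classical
  -- Appending `l` ones embeds the partitions of `n - l` into `k` parts among those that rigid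
  -- polynomials realise.
  let f : (n - l).Partition → n.Partition := fun μ =>
    ⟨μ.parts + Multiset.replicate l 1, fun {i} hi => by
      rcases Multiset.mem_add.mp hi with h | h
      · exact μ.parts_pos h
      · rw [Multiset.eq_of_mem_replicate h]; exact one_pos, by
      rw [Multiset.sum_add, μ.parts_sum, Multiset.sum_replicate, smul_eq_mul]
      omega⟩
  have hf : Function.Injective f := fun μ ν h =>
    Nat.Partition.ext (add_right_cancel (congrArg Nat.Partition.parts h))
  rw [← Finset.card_image_of_injective _ hf]
  set S := (partitionsInto (n - l) k).image f with hS
  have hmem : ∀ p ∈ S, ∃ μ : Multiset ℕ, μ.card = k ∧ p.parts = μ + Multiset.replicate l 1 := by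
    intro p hp
    obtain ⟨μ, hμ, rfl⟩ := Finset.mem_image.mp hp
    exact ⟨μ.parts, (Finset.mem_filter.mp hμ).2, rfl⟩
  calc S.card ≤ (P.biUnion fun q => S.filter fun p => PartitionLE p q).card := by
        refine Finset.card_le_card fun p hp => ?_
        obtain ⟨μ, hμ, hpμ⟩ := hmem p hp
        obtain ⟨q, hq, hle⟩ := exists_partitionLE_of_isVandermondeCovering hkl hsn hP hμ hpμ
        exact Finset.mem_biUnion.mpr ⟨q, hq, Finset.mem_filter.mpr ⟨hp, hle⟩⟩
    _ ≤ P.card * (k + 1).choose 2 := by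
        refine Finset.card_biUnion_le_card_mul _ _ _ fun q hq => ?_
        refine card_le_choose_of_partitionLE (Finset.mem_filter.mp (hP.1 hq)).2 fun p hp => ?_
        obtain ⟨hpS, hle⟩ := Finset.mem_filter.mp hp
        obtain ⟨μ, hμ, hpμ⟩ := hmem p hpS
        refine ⟨hle, ?_, ?_⟩
        · rw [hpμ, Multiset.card_add, hμ, Multiset.card_replicate]
        · rw [hpμ]; exact Multiset.le_add_left _ _

theorem ceil_le_card_of_isVandermondeCovering {n k l : ℕ} (hk : 0 < k)
    (hkl : k = l ∨ k = l + 1) (hsn : k + l + 1 ≤ n) {P : Finset n.Partition}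
    (hP : IsVandermondeCovering n (k + l + 1) P) :
    ⌈(2 * ((partitionsInto (n - (l + 1)) k).card : ℚ)) / ((k : ℚ) * ((k : ℚ) + 1))⌉ ≤
      (P.card : ℤ) := by
  -- The count yields a bound with `n - l`; the stated one, with `n - (l + 1)`, is weaker.
  have h1 := card_partitionsInto_le_succ (n - (l + 1)) hk
  rw [show n - (l + 1) + 1 = n - l by omega] at h1
  have h2 := h1.trans (card_partitionsInto_le_mul_choose hkl hsn hP)
  have h3 : 2 * (k + 1).choose 2 = k * (k + 1) := by
    rw [Nat.choose_two_right, Nat.mul_div_cancel' (Nat.even_mul_pred_self (k + 1)).two_dvd,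
      Nat.add_sub_cancel, mul_comm]
  have h4 : 2 * (partitionsInto (n - (l + 1)) k).card ≤ P.card * (k * (k + 1)) := by
    rw [← h3]; nlinarith
  rw [Int.ceil_le, Int.cast_natCast, div_le_iff₀ (by positivity)]
  exact_mod_cast h4

end Vandermonde

theorem proposition4 (n s : ℕ) (hs : 2 ≤ s) (hsn : s ≤ n) (P : Finset n.Partition)
    (hP : Vandermonde.IsVandermondeCovering n s P) :
    (P.card : ℤ) ≥
      ⌈(2 * ((Vandermonde.partitionsInto (n - ⌈(s : ℚ) / 2⌉₊) ⌊(s : ℚ) / 2⌋₊).card : ℚ)) /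
        ((⌈((s : ℚ) - 1) / 2⌉ : ℚ) * (⌈((s : ℚ) + 1) / 2⌉ : ℚ))⌉ := by
  obtain ⟨k, l, hk, hkl, rfl⟩ : ∃ k l, 0 < k ∧ (k = l ∨ k = l + 1) ∧ s = k + l + 1 :=
    ⟨s / 2, s - s / 2 - 1, by omega, by omega, by omega⟩
  have hkl' : (k : ℚ) = l ∨ (k : ℚ) = l + 1 := by exact_mod_cast hkl
  have hc : ⌈((k + l + 1 : ℕ) : ℚ) / 2⌉₊ = l + 1 := by
    rw [Nat.ceil_eq_iff (by omega)]
    push_cast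
    constructor <;> rcases hkl' with h | h <;> rw [h] <;> linarith
  have hf : ⌊((k + l + 1 : ℕ) : ℚ) / 2⌋₊ = k := by
    rw [Nat.floor_eq_iff (by positivity)]
    push_cast
    constructor <;> rcases hkl' with h | h <;> rw [h] <;> linarith
  have hd : ⌈(((k + l + 1 : ℕ) : ℚ) - 1) / 2⌉ = k := by
    rw [Int.ceil_eq_iff]
    push_cast
    constructor <;> rcases hkl' with h | h <;> rw [h] <;> linarith
  have he : ⌈(((k + l + 1 : ℕ) : ℚ) + 1) / 2⌉ = k + 1 := by
    rw [Int.ceil_eq_iff]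
    push_cast
    constructor <;> rcases hkl' with h | h <;> rw [h] <;> linarith
  rw [hc, hf, hd, he]
  push_cast
  exact Vandermonde.ceil_le_card_of_isVandermondeCovering hk hkl hsn hP
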